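/- Let $F$ be Thompson's group of all piecewise linear homeomorphisms of $[0,1]$ with finitely many breakpoints, all of them dyadic rationals, and all slopes integer powers of $2$. Let $X$ be the set of reduced tree-diagrams: pairs $(T_+,T_-)$ of finite binary trees with the same number of carets and no common caret (there is no $i$ such that the leaves $i$ and $i+1$ have a common father in both trees). Such a diagram represents the element of $F$ that maps, for each $i$, the dyadic interval of the $i$-th leaf of $T_+$ linearly onto that of the $i$-th leaf of $T_-$; in this way $X$ is identified with $F$. The size of an element of $X$ is the common number of carets of its two trees. Let $X_k$ be the set of unordered $k$-tuples (multisets) of elements of $X$. The size of a tuple is the sum of the sizes of its components in the sum model, and their maximum in the max model. Let $\mathrm{Sph}_k(n)\subseteq X_k$ be the (finite) set of tuples of size $n$. In either model, $T\subseteq X_k$ has asymptotic density $d$ if $|T\cap \mathrm{Sph}_k(n)|/|\mathrm{Sph}_k(n)|\to d$ as $n\to\infty$, and positive density if the $\liminf$ of this ratio is positive. A subgroup $H\le F$ is perpetual (in the given model) if, for all sufficiently large $k$, the set of tuples in $X_k$ that generate precisely the subgroup $H$ has positive density. **Lemma.** Let $H$ be an abelian subgroup of $F$. Then $H$ is not perpetual,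 neither in the sum model nor in the max model. Moreover, if $H$ is finitely generated, then for every $k\ge 1$ the set of all $k$-tuples in $X_k$ all of whose components represent elements of $H$ (that is, the tuples that generate a subgroup contained in $H$) has asymptotic density zero in both models. -/

import Mathlib

open Filter Topology unitInterval

namespace ThompsonF

/-! ## Thompson's group as a group of homeomorphisms of the unit interval -/

/-- `x` is a dyadic rational number. -/
def IsDyadic (x : ℝ) : Prop := ∃ (a : ℤ) (n : ℕ), x = a / 2 ^ n

/-- `g` is piecewise linear with finitely many breakpoints, all of them dyadic, and all its slopes
are integer powers of `2`: there is a finite set `S` of dyadic numbers such that `g` is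
linear, with slope `2 ^ k` for some integer `k`, on each interval `[x, y]` that has no point
of `S` in its interior. -/
def IsDyadicPL (g : I ≃ₜ I) : Prop :=
  ∃ S : Finset I, (∀ s ∈ S, IsDyadic (s : ℝ)) ∧
    ∀ x y : I, x < y → (∀ s ∈ S, ¬ (x < s ∧ s < y)) →
      ∃ k : ℤ, ∀ t ∈ Set.Icc x y, ((g t : ℝ) - (g x : ℝ)) = (2 : ℝ) ^ k * ((t : ℝ) - (x : ℝ))

theorem IsDyadic.add {x y : ℝ} (hx : IsDyadic x) (hy : IsDyadic y) : IsDyadic (x + y) := by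
  obtain ⟨a, n, rfl⟩ := hx
  obtain ⟨b, m, rfl⟩ := hy
  refine ⟨a * 2 ^ m + b * 2 ^ n, n + m, ?_⟩
  push_cast
  field_simp
  ring

theorem IsDyadic.neg {x : ℝ} (hx : IsDyadic x) : IsDyadic (-x) := by
  obtain ⟨a, n, rfl⟩ := hx
  exact ⟨-a, n, by push_cast; ring⟩

theorem IsDyadic.sub {x y : ℝ} (hx : IsDyadic x) (hy : IsDyadic y) : IsDyadic (x - y) := by
  rw [sub_eq_add_neg]
  exact hx.add hy.neg

theorem IsDyadic.zpow_mul {x : ℝ} (hx : IsDyadic x) (k : ℤ) : IsDyadic ((2 : ℝ) ^ k * x) := by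
  obtain ⟨a, n, rfl⟩ := hx
  obtain ⟨m, rfl | rfl⟩ := k.eq_nat_or_neg
  · refine ⟨2 ^ m * a, n, ?_⟩
    push_cast
    rw [zpow_natCast]
    ring
  · refine ⟨a, n + m, ?_⟩
    rw [zpow_neg, zpow_natCast]
    field_simp
    ring

theorem isDyadic_zero : IsDyadic 0 := ⟨0, 0, by simp⟩

theorem isDyadic_one : IsDyadic 1 := ⟨1, 0, by simp⟩

theorem IsDyadicPL.strictMono {g : I ≃ₜ I} (hg : IsDyadicPL g) : StrictMono g := by
  rcases g.continuous.strictMono_of_inj_boundedOrder' g.injective with h | h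
  · exact h
  · exfalso
    obtain ⟨S, -, hS⟩ := hg
    let S' : Finset I := insert 1 (S.filter (fun s => 0 < s))
    have hne : S'.Nonempty := ⟨1, by simp [S']⟩
    have hpos : (0 : I) < S'.min' hne := by
      rw [Finset.lt_min'_iff]
      intro s hs
      simp only [S', Finset.mem_insert, Finset.mem_filter] at hs
      rcases hs with rfl | hs
      · exact zero_lt_one
      · exact hs.2
    obtain ⟨k, hk⟩ := hS 0 (S'.min' hne) hpos (by
      rintro s hs ⟨h0, h1⟩
      have : S'.min' hne ≤ s := S'.min'_le s (by simp [S', hs, h0])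
      exact absurd h1 (not_lt.2 this))
    have h1 := hk _ (Set.right_mem_Icc.2 hpos.le)
    have h2 : (g (S'.min' hne) : ℝ) < g 0 := h hpos
    have h3 : (0 : ℝ) < (S'.min' hne : ℝ) - ((0 : I) : ℝ) := sub_pos.2 hpos
    have h4 : (0 : ℝ) < 2 ^ k * ((S'.min' hne : ℝ) - ((0 : I) : ℝ)) := by positivity
    linarith

theorem IsDyadicPL.map_zero {g : I ≃ₜ I} (hg : IsDyadicPL g) : g 0 = 0 := by
  obtain ⟨x, hx⟩ := g.surjective 0
  have h : g 0 ≤ g x := hg.strictMono.monotone unitInterval.nonneg'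
  rw [hx] at h
  exact le_antisymm h unitInterval.nonneg'

theorem IsDyadicPL.isDyadic_map {g : I ≃ₜ I} (hg : IsDyadicPL g) {x : I}
    (hx : IsDyadic (x : ℝ)) : IsDyadic (g x : ℝ) := by
  have h0 := hg.map_zero
  obtain ⟨S, hSd, hS⟩ := hg
  induction hn : (S.filter (fun s => s < x)).card using Nat.strong_induction_on generalizing x with
  | _ n ih =>
    rcases (unitInterval.nonneg' : (0 : I) ≤ x).eq_or_lt with hx0 | hx0
    · rw [← hx0, h0]
      exact isDyadic_zero
    let S' : Finset I := insert 0 (S.filter (fun s => s < x))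
    have hne : S'.Nonempty := ⟨0, by simp [S']⟩
    have hmem := S'.max'_mem hne
    have hlt : S'.max' hne < x := by
      rw [Finset.max'_lt_iff]
      intro s hs
      simp only [S', Finset.mem_insert, Finset.mem_filter] at hs
      rcases hs with rfl | hs
      · exact hx0
      · exact hs.2
    have hmd : IsDyadic (S'.max' hne : ℝ) ∧ IsDyadic (g (S'.max' hne) : ℝ) := by
      rcases Finset.mem_insert.1 hmem with h | h
      · rw [h, h0]
        exact ⟨isDyadic_zero, isDyadic_zero⟩
      · have hd := hSd _ (Finset.mem_filter.1 h).1
        refine ⟨hd, ih _ ?_ hd rfl⟩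
        rw [← hn]
        refine Finset.card_lt_card ?_
        rw [Finset.ssubset_iff_of_subset]
        · exact ⟨_, h, by simp⟩
        · intro s hs
          simp only [Finset.mem_filter] at hs ⊢
          exact ⟨hs.1, hs.2.trans hlt⟩
    obtain ⟨k, hk⟩ := hS _ x hlt (by
      rintro s hs ⟨h1, h2⟩
      have : s ≤ S'.max' hne := S'.le_max' s (by simp [S', hs, h2])
      exact absurd h1 (not_lt.2 this))
    have h1 := hk x (Set.right_mem_Icc.2 hlt.le)
    have h2 : (g x : ℝ) = 2 ^ k * ((x : ℝ) - (S'.max' hne : ℝ)) + (g (S'.max' hne) : ℝ) := by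
      linarith
    rw [h2]
    exact ((hx.sub hmd.1).zpow_mul k).add hmd.2

theorem IsDyadicPL.inv {g : I ≃ₜ I} (hg : IsDyadicPL g) : IsDyadicPL g⁻¹ := by
  have hgi (t : I) : g (g⁻¹ t) = t := g.apply_symm_apply t
  obtain ⟨S, hSd, hS⟩ := id hg
  classical
  refine ⟨S.image g, ?_, ?_⟩
  · intro s hs
    obtain ⟨t, ht, rfl⟩ := Finset.mem_image.1 hs
    exact hg.isDyadic_map (hSd t ht)
  · intro x y hxy hno
    obtain ⟨k, hk⟩ := hS (g⁻¹ x) (g⁻¹ y) (by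
      rw [← hg.strictMono.lt_iff_lt, hgi, hgi]; exact hxy) (by
      rintro s hs ⟨h1, h2⟩
      refine hno (g s) (Finset.mem_image_of_mem _ hs) ⟨?_, ?_⟩
      · simpa only [hgi] using hg.strictMono h1
      · simpa only [hgi] using hg.strictMono h2)
    refine ⟨-k, fun t ht => ?_⟩
    have h1 := hk (g⁻¹ t) ⟨by
      rw [← hg.strictMono.le_iff_le, hgi, hgi]; exact ht.1, by
      rw [← hg.strictMono.le_iff_le, hgi, hgi]; exact ht.2⟩
    rw [hgi, hgi] at h1
    rw [h1, ← mul_assoc, ← zpow_add₀ (two_ne_zero)]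
    simp

theorem IsDyadicPL.mul {f g : I ≃ₜ I} (hf : IsDyadicPL f) (hg : IsDyadicPL g) :
    IsDyadicPL (f * g) := by
  have hgi (t : I) : g (g⁻¹ t) = t := g.apply_symm_apply t
  have hmono := hg.strictMono
  obtain ⟨S, hSd, hS⟩ := hf
  obtain ⟨S', hSd', hS'⟩ := id hg
  classical
  refine ⟨S' ∪ S.image (⇑(g⁻¹)), ?_, ?_⟩
  · intro s hs
    rcases Finset.mem_union.1 hs with hs | hs
    · exact hSd' s hs
    · obtain ⟨t, ht, rfl⟩ := Finset.mem_image.1 hs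
      exact hg.inv.isDyadic_map (hSd t ht)
  · intro x y hxy hno
    obtain ⟨k', hk'⟩ := hS' x y hxy (fun s hs => hno s (Finset.mem_union_left _ hs))
    obtain ⟨k, hk⟩ := hS (g x) (g y) (hmono hxy) (by
      rintro s hs ⟨h1, h2⟩
      refine hno (g⁻¹ s) (Finset.mem_union_right _ (Finset.mem_image_of_mem _ hs)) ⟨?_, ?_⟩
      · rw [← hmono.lt_iff_lt, hgi]; exact h1
      · rw [← hmono.lt_iff_lt, hgi]; exact h2)
    refine ⟨k + k', fun t ht => ?_⟩
    have h1 := hk (g t) ⟨hmono.monotone ht.1, hmono.monotone ht.2⟩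
    rw [hk' t ht] at h1
    rw [Homeomorph.mul_apply, Homeomorph.mul_apply, h1, zpow_add₀ (two_ne_zero)]
    ring

theorem IsDyadicPL.one : IsDyadicPL 1 :=
  ⟨∅, by simp, fun _ _ _ _ => ⟨0, fun t _ => by simp⟩⟩

/-- Thompson's group `F`: all piecewise linear homeomorphisms of `[0, 1]` with finitely many
breakpoints, all of them dyadic, and with all slopes integer powers of `2`. -/
def thompsonF : Subgroup (I ≃ₜ I) where
  carrier := {g | IsDyadicPL g}
  mul_mem' := IsDyadicPL.mul
  one_mem' := IsDyadicPL.one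
  inv_mem' := IsDyadicPL.inv

/-! ## Tree-diagrams -/

/-- The branches of a finite binary tree, from left to right, as words over `{0, 1}`
(`false` is `0`, a left edge, and `true` is `1`, a right edge). A leaf is `nil`, a caret
is a `node`. -/
def branches : BinaryTree Unit → List (List Bool)
  | .nil => [[]]
  | .node _ l r => (branches l).map (List.cons false) ++ (branches r).map (List.cons true)

/-- For a finite binary word `u` and `x = .α` in `[0, 1]`, the point `.uα`. Thus `wordMap u` is the
increasing linear map of `[0, 1]` onto the dyadic interval `[u]`. -/
noncomputable def wordMap : List Bool → I → I
  | [], x => x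
  | false :: u, x => ⟨(wordMap u x : ℝ) / 2,
      by constructor <;> linarith [(wordMap u x).2.1, (wordMap u x).2.2]⟩
  | true :: u, x => ⟨(1 + (wordMap u x : ℝ)) / 2,
      by constructor <;> linarith [(wordMap u x).2.1, (wordMap u x).2.2]⟩

/-- A tree-diagram: a pair of finite binary trees with the same number of carets. -/
structure TreeDiagram where
  pos : BinaryTree Unit
  neg : BinaryTree Unit
  carets_eq : pos.numNodes = neg.numNodes

/-- The homeomorphism `g` is the function of the tree-diagram `D`: for each pair of branches
`u → v` of `D`, it takes `.uα` to `.vα`, for all `α`. -/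
def TreeDiagram.Represents (D : TreeDiagram) (g : I ≃ₜ I) : Prop :=
  ∀ p ∈ List.zip (branches D.pos) (branches D.neg), ∀ x : I, g (wordMap p.1 x) = wordMap p.2 x

/-- A tree-diagram is reduced if there is no `i` for which the leaves `i` and `i + 1` of
both trees have a common father. -/
def TreeDiagram.IsReduced (D : TreeDiagram) : Prop :=
  ¬ ∃ (i : ℕ) (u v : List Bool),
    (branches D.pos)[i]? = some (u ++ [false]) ∧ (branches D.pos)[i + 1]? = some (u ++ [true]) ∧
    (branches D.neg)[i]? = some (v ++ [false]) ∧ (branches D.neg)[i + 1]? = some (v ++ [true])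

theorem length_branches (T : BinaryTree Unit) : (branches T).length = T.numNodes + 1 := by
  induction T with
  | nil => rfl
  | node _ l r hl hr =>
    simp only [branches, List.length_append, List.length_map, hl, hr, BinaryTree.numNodes]
    ring

theorem coe_wordMap (u : List Bool) (x : I) :
    (wordMap u x : ℝ) = (wordMap u 0 : ℝ) + (2 : ℝ) ^ (-(u.length : ℤ)) * (x : ℝ) := by
  induction u with
  | nil => simp [wordMap]
  | cons b u ih =>
    have h : (2 : ℝ) ^ (-((u.length + 1 : ℕ) : ℤ)) = (2 : ℝ) ^ (-(u.length : ℤ)) / 2 := by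
      rw [Nat.cast_succ, neg_add, zpow_add₀ two_ne_zero, div_eq_mul_inv, zpow_neg_one]
    cases b <;>
    · simp only [wordMap, List.length_cons]
      rw [ih, h]
      ring

theorem isDyadic_wordMap_zero (u : List Bool) : IsDyadic (wordMap u 0 : ℝ) := by
  induction u with
  | nil => simpa [wordMap] using isDyadic_zero
  | cons b u ih =>
    cases b
    · have h := ih.zpow_mul (-1)
      rw [zpow_neg_one] at h
      simpa only [wordMap, div_eq_inv_mul] using h
    · have h := (isDyadic_one.add ih).zpow_mul (-1)
      rw [zpow_neg_one] at h
      simpa only [wordMap, div_eq_inv_mul] using h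

theorem exists_branch_wordMap_zero (T : BinaryTree Unit) :
    ∃ u ∈ branches T, wordMap u 0 = 0 := by
  induction T with
  | nil => exact ⟨[], by simp [branches], rfl⟩
  | node _ l r hl _ =>
    obtain ⟨u, hu, h⟩ := hl
    refine ⟨false :: u, by simp [branches, hu], ?_⟩
    apply Subtype.ext
    simp [wordMap, h]

/-- An interval whose interior avoids the left ends of the leaf intervals lies in a leaf interval. -/
theorem exists_branch (T : BinaryTree Unit) (x y : I) (hxy : x ≤ y)
    (hno : ∀ u ∈ branches T, ¬ (x < wordMap u 0 ∧ wordMap u 0 < y)) :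
    ∃ u ∈ branches T, ∃ a b : I, a ≤ b ∧ x = wordMap u a ∧ y = wordMap u b := by
  induction T generalizing x y with
  | nil => exact ⟨[], by simp [branches], x, y, hxy, rfl, rfl⟩
  | node _ l r hl hr =>
    have hxy' : (x : ℝ) ≤ y := hxy
    have hx0 := x.2.1
    have hy1 := y.2.2
    rcases le_or_gt (y : ℝ) (1 / 2) with hy | hy
    · obtain ⟨u, hu, a, b, hab, h1, h2⟩ := hl ⟨2 * x, by constructor <;> linarith⟩
        ⟨2 * y, by constructor <;> linarith⟩ (Subtype.coe_le_coe.1 (by dsimp only; linarith)) (by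
          rintro u hu ⟨h1, h2⟩
          refine hno (false :: u) (by simp [branches, hu]) ⟨?_, ?_⟩
          · rw [← Subtype.coe_lt_coe] at h1 ⊢
            simp only [wordMap] at h1 ⊢
            linarith
          · rw [← Subtype.coe_lt_coe] at h2 ⊢
            simp only [wordMap] at h2 ⊢
            linarith)
      refine ⟨false :: u, by simp [branches, hu], a, b, hab, ?_, ?_⟩
      · apply Subtype.ext
        simp only [wordMap, ← h1]
        ring
      · apply Subtype.ext
        simp only [wordMap, ← h2]
        ring
    · rcases le_or_gt (1 / 2) (x : ℝ) with hx | hx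
      · obtain ⟨u, hu, a, b, hab, h1, h2⟩ := hr ⟨2 * x - 1, by constructor <;> linarith⟩
          ⟨2 * y - 1, by constructor <;> linarith⟩ (Subtype.coe_le_coe.1 (by dsimp only; linarith)) (by
            rintro u hu ⟨h1, h2⟩
            refine hno (true :: u) (by simp [branches, hu]) ⟨?_, ?_⟩
            · rw [← Subtype.coe_lt_coe] at h1 ⊢
              simp only [wordMap] at h1 ⊢
              linarith
            · rw [← Subtype.coe_lt_coe] at h2 ⊢
              simp only [wordMap] at h2 ⊢
              linarith)
        refine ⟨true :: u, by simp [branches, hu], a, b, hab, ?_, ?_⟩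
        · apply Subtype.ext
          simp only [wordMap, ← h1]
          ring
        · apply Subtype.ext
          simp only [wordMap, ← h2]
          ring
      · exfalso
        obtain ⟨u, hu, h⟩ := exists_branch_wordMap_zero r
        refine hno (true :: u) (by simp [branches, hu]) ⟨?_, ?_⟩
        · rw [← Subtype.coe_lt_coe]
          simp only [wordMap, h, Set.Icc.coe_zero]
          linarith
        · rw [← Subtype.coe_lt_coe]
          simp only [wordMap, h, Set.Icc.coe_zero]
          linarith

/-- For each tree, an increasing map that takes the leaf intervals, from left to right, linearly
to the intervals `[0, 1]`, `[1, 2]`, ... -/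
theorem exists_leaf_chart (T : BinaryTree Unit) :
    ∃ e : ℝ ≃o ℝ, e 0 = 0 ∧ e 1 = (branches T).length ∧
      ∀ (i : ℕ) (hi : i < (branches T).length) (x : I),
        e (wordMap (branches T)[i] x : ℝ) = i + x := by
  induction T with
  | nil =>
    refine ⟨OrderIso.refl ℝ, by simp, by simp [branches], ?_⟩
    intro i hi x
    have : i = 0 := by simpa [branches] using hi
    subst this
    simp [branches, wordMap]
  | node _ l r hl hr =>
    obtain ⟨e, e0, e1, he⟩ := hl
    obtain ⟨f, f0, f1, hf⟩ := hr
    let n : ℝ := (branches l).length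
    let φ : ℝ → ℝ := fun x => if x ≤ 1 / 2 then e (2 * x) else n + f (2 * x - 1)
    have hle (x : ℝ) (hx : x ≤ 1 / 2) : φ x = e (2 * x) := if_pos hx
    have hge (x : ℝ) (hx : 1 / 2 ≤ x) : φ x = n + f (2 * x - 1) := by
      rcases hx.eq_or_lt with rfl | hx
      · rw [hle _ le_rfl]
        norm_num [e1, f0, n]
      · exact if_neg (not_le.2 hx)
    have hmono : StrictMono φ := by
      intro x y hxy
      rcases le_or_gt y (1 / 2) with hy | hy
      · rw [hle x (hxy.le.trans hy), hle y hy]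
        exact e.strictMono (by linarith)
      · rcases le_or_gt (1 / 2) x with hx | hx
        · rw [hge x hx, hge y hy.le]
          exact add_lt_add_right (f.strictMono (by linarith)) n
        · rw [hle x hx.le, hge y hy.le]
          have h1 : e (2 * x) < e 1 := e.strictMono (by linarith)
          have h2 : f 0 < f (2 * y - 1) := f.strictMono (by linarith)
          rw [e1] at h1
          rw [f0] at h2
          simp only [n]
          linarith
    have hsurj : Function.Surjective φ := by
      intro z
      rcases le_or_gt z n with hz | hz
      · refine ⟨e.symm z / 2, ?_⟩
        have : e.symm z ≤ 1 := by
          rw [e.symm_apply_le, e1]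
          exact hz
        rw [hle _ (by linarith), mul_div_cancel₀ _ two_ne_zero, e.apply_symm_apply]
      · refine ⟨(1 + f.symm (z - n)) / 2, ?_⟩
        have : 0 ≤ f.symm (z - n) := by
          rw [f.le_symm_apply, f0]
          linarith
        rw [hge _ (by linarith), mul_div_cancel₀ _ two_ne_zero, add_sub_cancel_left,
          f.apply_symm_apply]
        ring
    refine ⟨hmono.orderIsoOfSurjective φ hsurj, ?_, ?_, ?_⟩
    · simp only [StrictMono.coe_orderIsoOfSurjective]
      rw [hle 0 (by norm_num), mul_zero, e0]
    · simp only [StrictMono.coe_orderIsoOfSurjective]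
      rw [hge 1 (by norm_num), mul_one, show (2 : ℝ) - 1 = 1 by norm_num, f1]
      simp [branches, n]
    · intro i hi x
      simp only [StrictMono.coe_orderIsoOfSurjective]
      simp only [branches]
      rcases lt_or_ge i (branches l).length with h | h
      · rw [List.getElem_append_left (by simpa using h), List.getElem_map]
        simp only [wordMap]
        rw [hle _ (by linarith [(wordMap (branches l)[i] x).2.2]),
          mul_div_cancel₀ _ two_ne_zero, he i h x]
      · rw [List.getElem_append_right (by simpa using h), List.getElem_map]
        simp only [wordMap, List.length_map]
        have hi' : i - (branches l).length < (branches r).length := by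
          simp only [branches, List.length_append, List.length_map] at hi
          omega
        rw [hge _ (by linarith [(wordMap (branches r)[i - (branches l).length] x).2.1]),
          mul_div_cancel₀ _ two_ne_zero, add_sub_cancel_left, hf _ hi' x, Nat.cast_sub h]
        simp only [n]
        ring

/-- Each tree-diagram represents exactly one homeomorphism. -/
theorem TreeDiagram.existsUnique_represents (D : TreeDiagram) : ∃! g : I ≃ₜ I, D.Represents g := by
  have hlen : (branches D.pos).length = (branches D.neg).length := by
    rw [length_branches, length_branches, D.carets_eq]
  obtain ⟨e, e0, e1, he⟩ := exists_leaf_chart D.pos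
  obtain ⟨f, f0, f1, hf⟩ := exists_leaf_chart D.neg
  let φ : ℝ ≃o ℝ := e.trans f.symm
  have φ0 : φ 0 = 0 := by
    simp only [φ, OrderIso.trans_apply, e0]
    rw [← f0, f.symm_apply_apply, f0]
  have φ1 : φ 1 = 1 := by
    simp only [φ, OrderIso.trans_apply, e1]
    rw [hlen, ← f1, f.symm_apply_apply]
  have hφ (x : ℝ) : x ∈ I ↔ φ.toHomeomorph x ∈ I := by
    simp only [Set.mem_Icc, OrderIso.coe_toHomeomorph]
    have h0 := φ.le_iff_le (x := 0) (y := x)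
    have h1 := φ.le_iff_le (x := x) (y := 1)
    rw [φ0] at h0
    rw [φ1] at h1
    rw [h0, h1]
  refine ⟨φ.toHomeomorph.subtype hφ, ?_, ?_⟩
  · intro p hp x
    obtain ⟨i, hi, rfl⟩ := List.mem_iff_getElem.1 hp
    rw [List.length_zip] at hi
    rw [List.getElem_zip]
    apply Subtype.ext
    have h1 : i < (branches D.pos).length := by omega
    have h2 : i < (branches D.neg).length := by omega
    change f.symm (e (wordMap (branches D.pos)[i] x : ℝ)) = wordMap (branches D.neg)[i] x
    rw [he i h1 x, ← hf i h2 x, f.symm_apply_apply]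
  · intro g hg
    ext t
    obtain ⟨u, hu, a, -, -, rfl, -⟩ := exists_branch D.pos t t le_rfl
      (fun u _ h => lt_asymm h.1 h.2)
    obtain ⟨i, hi, rfl⟩ := List.mem_iff_getElem.1 hu
    have h2 : i < (branches D.neg).length := by omega
    have h3 := hg ((branches D.pos)[i], (branches D.neg)[i])
      (List.mem_iff_getElem.2 ⟨i, by rw [List.length_zip]; omega, List.getElem_zip⟩) a
    rw [h3]
    change _ = f.symm (e (wordMap (branches D.pos)[i] a : ℝ))
    rw [he i hi a, ← hf i h2 a, f.symm_apply_apply]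

theorem TreeDiagram.Represents.isDyadicPL {D : TreeDiagram} {g : I ≃ₜ I} (hg : D.Represents g) :
    IsDyadicPL g := by
  have hlen : (branches D.pos).length = (branches D.neg).length := by
    rw [length_branches, length_branches, D.carets_eq]
  classical
  refine ⟨((branches D.pos).map (fun u => wordMap u 0)).toFinset, ?_, ?_⟩
  · intro s hs
    simp only [List.mem_toFinset, List.mem_map] at hs
    obtain ⟨u, -, rfl⟩ := hs
    exact isDyadic_wordMap_zero u
  · intro x y hxy hno
    obtain ⟨u, hu, a, b, hab, rfl, rfl⟩ := exists_branch D.pos x y hxy.le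
      (fun u hu => hno _ (by simpa using ⟨u, hu, rfl⟩))
    obtain ⟨i, hi, rfl⟩ := List.mem_iff_getElem.1 hu
    have h2 : i < (branches D.neg).length := by omega
    have h3 := hg ((branches D.pos)[i], (branches D.neg)[i])
      (List.mem_iff_getElem.2 ⟨i, by rw [List.length_zip]; omega, List.getElem_zip⟩)
    simp only at h3
    set u := (branches D.pos)[i]
    set v := (branches D.neg)[i]
    refine ⟨(u.length : ℤ) - v.length, fun t ht => ?_⟩
    have hpos : (0 : ℝ) < (2 : ℝ) ^ (-(u.length : ℤ)) := by positivity
    have ht1 : (wordMap u a : ℝ) ≤ t := ht.1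
    have ht2 : (t : ℝ) ≤ wordMap u b := ht.2
    rw [coe_wordMap u a] at ht1
    rw [coe_wordMap u b] at ht2
    have hc : ∃ c : I, t = wordMap u c := by
      refine ⟨⟨((t : ℝ) - wordMap u 0) / (2 : ℝ) ^ (-(u.length : ℤ)), ?_, ?_⟩, ?_⟩
      · refine div_nonneg ?_ hpos.le
        nlinarith [a.2.1]
      · rw [div_le_one hpos]
        nlinarith [b.2.2]
      · apply Subtype.ext
        rw [coe_wordMap]
        field_simp
        ring
    obtain ⟨c, rfl⟩ := hc
    rw [h3, h3, coe_wordMap v c, coe_wordMap v a, coe_wordMap u c, coe_wordMap u a]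
    have h4 : (2 : ℝ) ^ (-(v.length : ℤ)) =
        (2 : ℝ) ^ ((u.length : ℤ) - v.length) * (2 : ℝ) ^ (-(u.length : ℤ)) := by
      rw [← zpow_add₀ two_ne_zero]
      congr 1
      ring
    rw [h4]
    ring

/-- The set `X` of all reduced tree-diagrams. -/
def X : Type := {D : TreeDiagram // D.IsReduced}

/-- The element of `F` that is represented by a given reduced tree-diagram. -/
noncomputable def X.toF (D : X) : thompsonF :=
  ⟨D.1.existsUnique_represents.choose,
    TreeDiagram.Represents.isDyadicPL D.1.existsUnique_represents.choose_spec.1⟩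

/-- The size of a reduced tree-diagram: the common number of carets of its two trees. -/
def X.size (D : X) : ℕ := D.1.pos.numNodes

/-! ## Random tuples, asymptotic density -/

/-- The size of an unordered `k`-tuple in the sum model. -/
def sumSize {k : ℕ} (s : Sym X k) : ℕ := ((s : Multiset X).map X.size).sum

/-- The size of an unordered `k`-tuple in the max model. -/
def maxSize {k : ℕ} (s : Sym X k) : ℕ := ((s : Multiset X).map X.size).sup

/-- The sphere of radius `n` in the set of unordered `k`-tuples, for a given notion of size. -/
def Sph {k : ℕ} (size : Sym X k → ℕ) (n : ℕ) : Set (Sym X k) := {s | size s = n}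

theorem finite_size_le (n : ℕ) : {D : X | D.size ≤ n}.Finite := by
  let A : Set (BinaryTree Unit) := ⋃ i ∈ Finset.range (n + 1), ↑(BinaryTree.treesOfNumNodesEq i)
  have hA : A.Finite :=
    Set.Finite.biUnion (Finset.finite_toSet _) (fun i _ => Finset.finite_toSet _)
  refine Set.Finite.of_finite_image (f := fun D : X => (D.1.pos, D.1.neg))
    ((hA.prod hA).subset ?_) ?_
  · rintro _ ⟨D, hD, rfl⟩
    have h1 : D.1.pos.numNodes ≤ n := hD
    have h2 := D.1.carets_eq
    refine ⟨?_, ?_⟩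
    · simp only [A, Set.mem_iUnion, Finset.mem_coe, BinaryTree.mem_treesOfNumNodesEq]
      exact ⟨_, Finset.mem_range.2 (by omega), rfl⟩
    · simp only [A, Set.mem_iUnion, Finset.mem_coe, BinaryTree.mem_treesOfNumNodesEq]
      exact ⟨_, Finset.mem_range.2 (by omega), rfl⟩
  · rintro ⟨⟨p, q, h⟩, hD⟩ - ⟨⟨p', q', h'⟩, hD'⟩ - heq
    simp only [Prod.mk.injEq] at heq
    obtain ⟨rfl, rfl⟩ := heq
    rfl

theorem finite_maxSize_le (k n : ℕ) : {s : Sym X k | maxSize s ≤ n}.Finite := by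
  have := (finite_size_le n).to_subtype
  refine (Set.finite_range (fun s : Sym {D : X | D.size ≤ n} k => s.map Subtype.val)).subset ?_
  intro s hs
  have hs' : ∀ D ∈ s, D ∈ {D : X | D.size ≤ n} := by
    intro D hD
    have h1 : D.size ≤ maxSize s := Multiset.le_sup (Multiset.mem_map_of_mem X.size hD)
    exact h1.trans hs
  refine ⟨s.attach.map (fun D => ⟨D.1, hs' D.1 D.2⟩), ?_⟩
  simp only [Sym.map_map, Function.comp_def]
  exact Sym.attach_map_coe s

/-- The spheres of both models are finite, so that `Set.ncard` below is the number of
elements. -/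
theorem finite_Sph_maxSize (k n : ℕ) : (Sph (maxSize (k := k)) n).Finite :=
  (finite_maxSize_le k n).subset (fun _ hs => le_of_eq hs)

theorem finite_Sph_sumSize (k n : ℕ) : (Sph (sumSize (k := k)) n).Finite := by
  refine (finite_maxSize_le k n).subset (fun s hs => ?_)
  have hs' : sumSize s = n := hs
  have h : maxSize s ≤ sumSize s := Multiset.sup_le.2
    (fun b hb => Multiset.single_le_sum (fun x _ => Nat.zero_le x) b hb)
  exact h.trans hs'.le

/-- The proportion of the sphere of radius `n` that lies in `T`. -/
noncomputable def proportion {k : ℕ} (size : Sym X k → ℕ) (T : Set (Sym X k)) (n : ℕ) : ℝ :=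
  ((T ∩ Sph size n).ncard : ℝ) / ((Sph size n).ncard : ℝ)

/-- `T` has asymptotic density `d` for the given notion of size. -/
def HasAsymptoticDensity {k : ℕ} (size : Sym X k → ℕ) (T : Set (Sym X k)) (d : ℝ) : Prop :=
  Tendsto (proportion size T) atTop (𝓝 d)

/-- `T` has positive asymptotic density for the given notion of size. -/
def HasPositiveDensity {k : ℕ} (size : Sym X k → ℕ) (T : Set (Sym X k)) : Prop :=
  0 < liminf (proportion size T) atTop

/-- The unordered `k`-tuples whose components all represent elements of `H`, that is,
those that generate a subgroup which is contained in `H`. -/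
def tuplesIn (k : ℕ) (H : Subgroup thompsonF) : Set (Sym X k) :=
  {s | ∀ D ∈ s, D.toF ∈ H}

/-- The unordered `k`-tuples that generate `H`. -/
def tuplesGenerating (k : ℕ) (H : Subgroup thompsonF) : Set (Sym X k) :=
  {s | Subgroup.closure {g | ∃ D ∈ s, D.toF = g} = H}

/-- `H` is perpetual for a given notion of size: for each large enough `k`, a
random `k`-tuple generates precisely `H` with positive asymptotic probability. (Finite
generation of `H` is implied.) -/
def IsPerpetual (size : (k : ℕ) → Sym X k → ℕ) (H : Subgroup thompsonF) : Prop :=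
  ∃ K : ℕ, ∀ k ≥ K, HasPositiveDensity (size k) (tuplesGenerating k H)

end ThompsonF

/-!
An abelian subgroup `H` of Thompson's group that is finitely generated has polynomial growth with
respect to the number of carets, whereas the number of all reduced tree-diagrams grows
exponentially; the density of the tuples in `H` is therefore zero.

*Polynomial growth.* For `g` in `F`, let `movedRight g` be the set of fixed points of `g` at which
`g` has a nontrivial right germ. It is finite, because two fixed points on one linear piece of `g`
force slope `1` there. An element that commutes with `g` permutes `movedRight g`, and as it is
increasing, it fixes each point (`IsDyadicPL.apply_eq_of_commute`). If `H` is generated by a finite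
set `A`, let `P` be the finite union of the sets `movedRight a` for `a` in `A`. A nontrivial `g` in
`H` has a nontrivial right germ at the left end `p` of a component of its support; all of `H` fixes
`p`, so some generator has a nontrivial germ there too, and `p` lies in `P`
(`exists_finite_germ_points`). Hence an element of `H` is determined by its right slopes at the
points of `P`. For an element with `n` carets these slopes are among `2 ^ (-n)`, ..., `2 ^ n`
(`X.exists_slope_right`), which leaves at most `(2 * n + 1) ^ |P|` elements. As reduced diagrams
represent distinct elements (`X.toF_injective`), this also bounds the number of diagrams
(`exists_ncard_le_pow`).

*Exponential growth of spheres.* Pairing an arbitrary tree under the left edge of a root caret with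
a right comb gives a reduced diagram, so there are at least `catalan n` reduced diagrams of size
`n + 1` (`catalan_le_ncard`). Padding with trivial diagrams embeds them into the sphere of `k`-tuples
in either model, while the tuples in `H` on that sphere are at most polynomially many
(`hasAsymptoticDensity_zero`).

*Perpetuality.* A tuple that generates `H` lies in `H`, and exists only if `H` is finitely
generated; so in either case the tuples that generate `H` have density zero.
-/

namespace ThompsonF

/-! ### Uniqueness of reduced tree-diagrams -/

theorem wordMap_append (u v : List Bool) (x : I) : wordMap (u ++ v) x = wordMap u (wordMap v x) := by
  induction u with
  | nil => rfl
  | cons b u ih => cases b <;> simp [wordMap, ih]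

theorem wordMap_zero_lt_wordMap_one (u : List Bool) : (wordMap u 0 : ℝ) < wordMap u 1 := by
  rw [coe_wordMap u 1]
  simp only [Set.Icc.coe_one, mul_one, lt_add_iff_pos_right]
  positivity

/-- A dyadic interval determines its word. -/
theorem wordMap_injective : Function.Injective wordMap := by
  intro u
  induction u with
  | nil =>
    rintro (_ | ⟨_ | _, v⟩) h
    · rfl
    · have h1 := congrArg Subtype.val (congrFun h 1)
      simp only [wordMap, Set.Icc.coe_one] at h1
      linarith [(wordMap v 1).2.2]
    · have h1 := congrArg Subtype.val (congrFun h 0)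
      simp only [wordMap, Set.Icc.coe_zero] at h1
      linarith [(wordMap v 0).2.1]
  | cons b u ih =>
    rintro (_ | ⟨c, v⟩) h
    · cases b
      · have h1 := congrArg Subtype.val (congrFun h 1)
        simp only [wordMap, Set.Icc.coe_one] at h1
        linarith [(wordMap u 1).2.2]
      · have h1 := congrArg Subtype.val (congrFun h 0)
        simp only [wordMap, Set.Icc.coe_zero] at h1
        linarith [(wordMap u 0).2.1]
    · have hu := wordMap_zero_lt_wordMap_one u
      have hv := wordMap_zero_lt_wordMap_one v
      have h0 := congrArg Subtype.val (congrFun h 0)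
      have h1 := congrArg Subtype.val (congrFun h 1)
      have hx (x : I) := congrArg Subtype.val (congrFun h x)
      cases b <;> cases c <;> simp only [wordMap] at h0 h1 hx
      · exact congrArg _ (ih (funext fun x => Subtype.ext (by linarith [hx x])))
      · linarith [(wordMap u 1).2.2, (wordMap v 0).2.1]
      · linarith [(wordMap v 1).2.2, (wordMap u 0).2.1]
      · exact congrArg _ (ih (funext fun x => Subtype.ext (by linarith [hx x])))

theorem branches_ne_nil (T : BinaryTree Unit) : branches T ≠ [] := by
  rw [← List.length_pos_iff, length_branches]
  omega

/-- Of two distinct trees, one has a branch that properly extends a branch of the other. -/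
theorem exists_strict_prefix (T T' : BinaryTree Unit) (h : T ≠ T') :
    ∃ (u : List Bool) (b : Bool) (s : List Bool),
      (u ∈ branches T ∧ u ++ b :: s ∈ branches T') ∨
      (u ∈ branches T' ∧ u ++ b :: s ∈ branches T) := by
  induction T generalizing T' with
  | nil =>
    cases T' with
    | nil => exact absurd rfl h
    | node a l r =>
      obtain ⟨s, hs⟩ := List.exists_mem_of_ne_nil _ (branches_ne_nil l)
      exact ⟨[], false, s, Or.inl (by simp [branches, hs])⟩
  | node a l r hl hr =>
    cases T' with
    | nil =>
      obtain ⟨s, hs⟩ := List.exists_mem_of_ne_nil _ (branches_ne_nil l)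
      exact ⟨[], false, s, Or.inr (by simp [branches, hs])⟩
    | node a' l' r' =>
      by_cases hll : l = l'
      · have hrr : r ≠ r' := by
          rintro rfl
          exact h (by rw [hll])
        obtain ⟨u, b, s, hus⟩ := hr r' hrr
        exact ⟨true :: u, b, s, by simpa [branches] using hus⟩
      · obtain ⟨u, b, s, hus⟩ := hl l' hll
        exact ⟨false :: u, b, s, by simpa [branches] using hus⟩

theorem branches_injective : Function.Injective branches := by
  have key (T : BinaryTree Unit) (u : List Bool) (hu : u ∈ branches T) (b : Bool) (s : List Bool) :
      u ++ b :: s ∉ branches T := by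
    induction T generalizing u with
    | nil => simp [branches]
    | node a l r hl hr =>
      simp only [branches, List.mem_append, List.mem_map] at hu
      rcases hu with ⟨u, hu, rfl⟩ | ⟨u, hu, rfl⟩
      · simpa [branches] using hl u hu
      · simpa [branches] using hr u hu
  intro T T' h
  by_contra hne
  obtain ⟨u, b, s, ⟨h1, h2⟩ | ⟨h1, h2⟩⟩ := exists_strict_prefix T T' hne
  · exact key T u h1 b s (h ▸ h2)
  · exact key T' u h1 b s (h ▸ h2)

/-- Below each vertex of a tree that is not a leaf there are two consecutive leaves with a common
father. -/
theorem exists_exposed_caret (T : BinaryTree Unit) (w : List Bool) (b : Bool) (t : List Bool)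
    (h : w ++ b :: t ∈ branches T) : ∃ (i : ℕ) (s : List Bool),
      (branches T)[i]? = some (w ++ s ++ [false]) ∧
      (branches T)[i + 1]? = some (w ++ s ++ [true]) := by
  induction T generalizing w b t with
  | nil => simp [branches] at h
  | node a l r hl hr =>
    -- An exposed caret of a subtree is one of the whole tree.
    have left (i : ℕ) (x y : List Bool) (hx : (branches l)[i]? = some x)
        (hy : (branches l)[i + 1]? = some y) :
        (branches (.node a l r))[i]? = some (false :: x) ∧
        (branches (.node a l r))[i + 1]? = some (false :: y) := by
      have h1 := (List.getElem?_eq_some_iff.1 hx).1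
      have h2 := (List.getElem?_eq_some_iff.1 hy).1
      constructor
      · rw [branches, List.getElem?_append_left (by simpa using h1), List.getElem?_map, hx]; rfl
      · rw [branches, List.getElem?_append_left (by simpa using h2), List.getElem?_map, hy]; rfl
    have right (i : ℕ) (x y : List Bool) (hx : (branches r)[i]? = some x)
        (hy : (branches r)[i + 1]? = some y) :
        (branches (.node a l r))[(branches l).length + i]? = some (true :: x) ∧
        (branches (.node a l r))[(branches l).length + i + 1]? = some (true :: y) := by
      constructor
      · rw [branches, List.getElem?_append_right (by simp), List.getElem?_map]
        simp [hx]
      · rw [branches, List.getElem?_append_right (by simp; omega), List.getElem?_map]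
        simp [add_assoc, hy]
    cases w with
    | nil =>
      cases l with
      | node a' l₁ l₂ =>
        obtain ⟨s, hs⟩ := List.exists_mem_of_ne_nil _ (branches_ne_nil l₁)
        obtain ⟨i, s, h1, h2⟩ := hl [] false s (by simp [branches, hs])
        exact ⟨i, false :: s, left i _ _ h1 h2⟩
      | nil =>
        cases r with
        | node a' r₁ r₂ =>
          obtain ⟨s, hs⟩ := List.exists_mem_of_ne_nil _ (branches_ne_nil r₁)
          obtain ⟨i, s, h1, h2⟩ := hr [] false s (by simp [branches, hs])
          exact ⟨_, true :: s, right i _ _ h1 h2⟩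
        | nil => exact ⟨0, [], by simp [branches], by simp [branches]⟩
    | cons c w =>
      cases c
      · obtain ⟨i, s, h1, h2⟩ := hl w b t (by simpa [branches] using h)
        exact ⟨i, s, left i _ _ h1 h2⟩
      · obtain ⟨i, s, h1, h2⟩ := hr w b t (by simpa [branches] using h)
        exact ⟨_, s, right i _ _ h1 h2⟩

theorem TreeDiagram.length_branches_eq (D : TreeDiagram) :
    (branches D.pos).length = (branches D.neg).length := by
  rw [length_branches, length_branches, D.carets_eq]

theorem TreeDiagram.Represents.apply_getElem? {D : TreeDiagram} {g : I ≃ₜ I} (hg : D.Represents g)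
    {i : ℕ} {u : List Bool} (hu : (branches D.pos)[i]? = some u) :
    ∃ v, (branches D.neg)[i]? = some v ∧ ∀ x, g (wordMap u x) = wordMap v x := by
  obtain ⟨hi, rfl⟩ := List.getElem?_eq_some_iff.1 hu
  have hi' := D.length_branches_eq ▸ hi
  refine ⟨_, List.getElem?_eq_getElem hi', hg ((branches D.pos)[i], (branches D.neg)[i])
    (List.mem_iff_getElem.2 ⟨i, by rw [List.length_zip]; omega, List.getElem_zip⟩)⟩

/-- If `D` is reduced, then the function of `D` does not map the interval of any vertex that lies
strictly above a leaf of the first tree linearly onto a dyadic interval: otherwise the second tree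
would contain a copy of the subtree below that vertex, and hence a common caret. -/
theorem TreeDiagram.IsReduced.append_notMem {D : TreeDiagram} (hD : D.IsReduced) {g : I ≃ₜ I}
    (hg : D.Represents g) {u v : List Bool} (huv : ∀ x, g (wordMap u x) = wordMap v x)
    (b : Bool) (t : List Bool) : u ++ b :: t ∉ branches D.pos := by
  intro h
  obtain ⟨i, s, h1, h2⟩ := exists_exposed_caret _ _ _ _ h
  obtain ⟨v₁, hv₁, e₁⟩ := hg.apply_getElem? h1
  obtain ⟨v₂, hv₂, e₂⟩ := hg.apply_getElem? h2
  refine hD ⟨i, u ++ s, v ++ s, h1, h2, ?_, ?_⟩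
  · rw [hv₁, wordMap_injective (a₁ := v₁) (a₂ := v ++ s ++ [false]) (funext fun x => ?_)]
    rw [← e₁, List.append_assoc, List.append_assoc, wordMap_append, wordMap_append v, huv]
  · rw [hv₂, wordMap_injective (a₁ := v₂) (a₂ := v ++ s ++ [true]) (funext fun x => ?_)]
    rw [← e₂, List.append_assoc, List.append_assoc, wordMap_append, wordMap_append v, huv]

theorem X.represents_toF (D : X) : D.1.Represents (D.toF : I ≃ₜ I) :=
  D.1.existsUnique_represents.choose_spec.1

/-- Each element of `F` is represented by at most one reduced tree-diagram. -/
theorem X.toF_injective : Function.Injective X.toF := by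
  have aux (D D' : X) (h : D.toF = D'.toF) (u : List Bool) (b : Bool) (s : List Bool)
      (hu : u ∈ branches D.1.pos) : u ++ b :: s ∉ branches D'.1.pos := by
    obtain ⟨i, hi⟩ := List.mem_iff_getElem?.1 hu
    obtain ⟨v, -, hv⟩ := D.represents_toF.apply_getElem? hi
    exact D'.2.append_notMem D'.represents_toF (h ▸ hv) b s
  intro D D' h
  have hpos : D.1.pos = D'.1.pos := by
    by_contra hne
    obtain ⟨u, b, s, ⟨h1, h2⟩ | ⟨h1, h2⟩⟩ := exists_strict_prefix _ _ hne
    · exact aux D D' h u b s h1 h2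
    · exact aux D' D h.symm u b s h1 h2
  have hneg : D.1.neg = D'.1.neg := by
    refine branches_injective (List.ext_getElem? fun i => ?_)
    rcases lt_or_ge i (branches D.1.pos).length with hi | hi
    · obtain ⟨v, hv, e⟩ := D.represents_toF.apply_getElem? (List.getElem?_eq_getElem hi)
      obtain ⟨v', hv', e'⟩ := D'.represents_toF.apply_getElem?
        ((congrArg (fun T => (branches T)[i]?) hpos).symm.trans (List.getElem?_eq_getElem hi))
      rw [hv, hv', wordMap_injective (a₁ := v) (a₂ := v') (funext fun x => ?_)]
      rw [← e, ← e', h]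
    · have h1 := D.1.length_branches_eq
      have h2 := D'.1.length_branches_eq
      rw [← hpos] at h2
      rw [List.getElem?_eq_none (by omega), List.getElem?_eq_none (by omega)]
  obtain ⟨⟨p, q, hpq⟩, hD⟩ := D
  obtain ⟨⟨p', q', hpq'⟩, hD'⟩ := D'
  obtain rfl : p = p' := hpos
  obtain rfl : q = q' := hneg
  rfl

/-! ### The number of reduced tree-diagrams -/

/-- The tree with `n` carets all of which lie on the right side. -/
def rightComb : ℕ → BinaryTree Unit
  | 0 => .nil
  | n + 1 => .node () .nil (rightComb n)

theorem numNodes_rightComb (n : ℕ) : (rightComb n).numNodes = n := by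
  induction n with
  | zero => rfl
  | succ n ih => simp [rightComb, BinaryTree.numNodes, ih]

theorem getElem?_branches_rightComb (n i : ℕ) (v : List Bool)
    (h : (branches (rightComb n))[i]? = some (v ++ [false]))
    (h' : (branches (rightComb n))[i + 1]? = some (v ++ [true])) : i + 1 = n := by
  induction n generalizing i v with
  | zero => simp [rightComb, branches] at h'
  | succ n ih =>
    simp only [rightComb, branches, List.map_cons, List.map_nil, List.singleton_append,
      List.getElem?_cons_succ, List.getElem?_map, Option.map_eq_some_iff] at h h'
    obtain ⟨w, hw, hw'⟩ := h'
    cases v with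
    | nil =>
      obtain rfl : w = [] := by simpa using hw'
      cases n with
      | zero =>
        have := (List.getElem?_eq_some_iff.1 hw).1
        simp [rightComb, branches] at this
        omega
      | succ n =>
        have := List.mem_of_getElem? hw
        simp [rightComb, branches] at this
    | cons c v =>
      obtain ⟨rfl, rfl⟩ : true = c ∧ w = v ++ [true] := by simpa using hw'
      cases i with
      | zero => simp at h
      | succ i =>
        simp only [List.getElem?_cons_succ, List.getElem?_map, Option.map_eq_some_iff] at h
        obtain ⟨z, hz, hz'⟩ := h
        obtain rfl : z = v ++ [false] := by simpa using hz'
        rw [ih i v hz hw]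

/-- The tree-diagram whose first tree consists of a root caret with `T` hanging from its left
leaf, and whose second tree is a right comb. -/
def combDiagram (T : BinaryTree Unit) : TreeDiagram where
  pos := .node () T .nil
  neg := rightComb (T.numNodes + 1)
  carets_eq := by simp [numNodes_rightComb, BinaryTree.numNodes]

/-- The only exposed caret of the comb carries the last two leaves, which are not siblings in the
first tree. -/
theorem combDiagram_isReduced {T : BinaryTree Unit} (hT : T.numNodes ≠ 0) :
    (combDiagram T).IsReduced := by
  rintro ⟨i, u, v, h1, h2, h3, h4⟩
  have hi := getElem?_branches_rightComb _ _ _ h3 h4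
  have hlen := length_branches T
  obtain rfl : i = T.numNodes := by omega
  simp only [combDiagram, branches] at h1 h2
  rw [List.getElem?_append_right (by simp; omega)] at h2
  obtain rfl : u = [] := by
    simp only [hlen, List.length_map, Nat.sub_self, List.map_cons, List.map_nil,
      List.getElem?_cons_zero, Option.some.injEq] at h2
    simpa using congrArg List.length h2
  rw [List.getElem?_append_left (by simp; omega), List.getElem?_map, Option.map_eq_some_iff] at h1
  obtain ⟨w, hw, hw'⟩ := h1
  obtain rfl : w = [] := by simpa using hw'
  cases T with
  | nil => exact hT rfl
  | node a l r =>
    have := List.mem_of_getElem? hw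
    simp [branches] at this

/-- The tree that hangs from the left edge of the root of the first tree can be any tree with `n`
carets. -/
theorem catalan_le_ncard (n : ℕ) (hn : n ≠ 0) : catalan n ≤ {D : X | D.size = n + 1}.ncard := by
  have hfin : {D : X | D.size = n + 1}.Finite :=
    (finite_size_le (n + 1)).subset fun D hD => le_of_eq hD
  rw [← BinaryTree.treesOfNumNodesEq_card_eq_catalan, ← Set.ncard_coe_finset]
  refine le_trans (Set.ncard_le_ncard ?_ (hfin.image fun D => D.1.pos.left))
    (Set.ncard_image_le hfin)
  intro T hT
  have hT' : T.numNodes = n := BinaryTree.mem_treesOfNumNodesEq.1 hT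
  exact ⟨⟨combDiagram T, combDiagram_isReduced (hT' ▸ hn)⟩,
    congrArg (· + 1) hT', rfl⟩

theorem four_pow_le_catalan (n : ℕ) (hn : n ≠ 0) : 4 ^ n ≤ 2 * (n + 1) ^ 2 * catalan n := by
  have h1 := Nat.four_pow_le_two_mul_self_mul_centralBinom n (Nat.pos_of_ne_zero hn)
  rw [← succ_mul_catalan_eq_centralBinom] at h1
  nlinarith [Nat.zero_le (catalan n), Nat.zero_le n]

/-! ### Fixed points and germs -/

/-- The points that `g` fixes, but no right neighbourhood of which it fixes pointwise. For `p = 1`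
the right neighbourhoods in `[0, 1]` include `{1}`, so that `1` never belongs to this set. -/
def movedRight (g : I ≃ₜ I) : Set I := {p | g p = p ∧ ¬ ∀ᶠ t in 𝓝[≥] p, g t = t}

theorem lt_one_of_mem_movedRight {g : I ≃ₜ I} {p : I} (hp : p ∈ movedRight g) : p < 1 := by
  refine lt_of_le_of_ne unitInterval.le_one' fun h => hp.2 ?_
  subst h
  filter_upwards [self_mem_nhdsWithin] with t ht
  rw [le_antisymm unitInterval.le_one' ht]
  exact hp.1

theorem IsDyadicPL.exists_linear_right {g : I ≃ₜ I} (hg : IsDyadicPL g) :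
    ∃ S : Finset I, ∀ p < 1, ∃ y ∈ S, p < y ∧
      ∃ k : ℤ, ∀ t ∈ Set.Icc p y, (g t : ℝ) - g p = (2 : ℝ) ^ k * ((t : ℝ) - p) := by
  obtain ⟨S, -, hS⟩ := hg
  refine ⟨insert 1 S, fun p hp => ?_⟩
  have hne : ((insert 1 S : Finset I).filter (p < ·)).Nonempty := ⟨1, by simp [hp]⟩
  have hmem := Finset.mem_filter.1 (Finset.min'_mem _ hne)
  refine ⟨_, hmem.1, hmem.2, hS _ _ hmem.2 ?_⟩
  rintro s hs ⟨h1, h2⟩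
  exact absurd h2 (not_lt.2 (Finset.min'_le _ s (by simp [hs, h1])))

theorem IsDyadicPL.finite_movedRight {g : I ≃ₜ I} (hg : IsDyadicPL g) : (movedRight g).Finite := by
  obtain ⟨S, hS⟩ := hg.exists_linear_right
  choose! N hN hlt hk using hS
  refine Set.Finite.of_finite_image (f := N) (S.finite_toSet.subset ?_) ?_
  · rintro _ ⟨p, hp, rfl⟩
    exact hN p (lt_one_of_mem_movedRight hp)
  -- Two fixed points on one linear piece force its slope to be `1`.
  have key (p q : I) (hp : p ∈ movedRight g) (hq : q ∈ movedRight g) (h : N p = N q) :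
      ¬ p < q := by
    intro hpq
    have hp1 := lt_one_of_mem_movedRight hp
    have hq1 := lt_one_of_mem_movedRight hq
    obtain ⟨k, hk⟩ := hk p hp1
    have h1 := hk q ⟨hpq.le, h ▸ (hlt q hq1).le⟩
    rw [hp.1, hq.1] at h1
    have hpq' : (0 : ℝ) < (q : ℝ) - p := sub_pos.2 hpq
    have h2 : (2 : ℝ) ^ k = 1 := by
      have : ((2 : ℝ) ^ k - 1) * ((q : ℝ) - p) = 0 := by linarith
      rcases mul_eq_zero.1 this with h | h <;> linarith
    refine hp.2 ?_
    filter_upwards [Icc_mem_nhdsGE (hlt p hp1)] with t ht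
    have h3 := hk t ht
    rw [hp.1, h2] at h3
    exact Subtype.ext (by linarith)
  intro p hp q hq h
  exact le_antisymm (not_lt.1 (key q p hq hp h.symm)) (not_lt.1 (key p q hp hq h))

/-- A strictly increasing self-map of a finite subset of a linear order is the identity. -/
theorem eq_of_strictMono_of_mapsTo {α : Type*} [LinearOrder α] {f : α → α} (hf : StrictMono f)
    {s : Set α} (hs : s.Finite) (h : Set.MapsTo f s s) {x : α} (hx : x ∈ s) : f x = x := by
  have := hs.to_subtype
  have hm : StrictMono (h.restrict f s s) := fun a b hab => hf hab
  exact congrArg Subtype.val (le_antisymm (hm.apply_le (x := ⟨x, hx⟩)) hm.le_apply)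

/-- If `h` commutes with `g`, then `h` permutes the finite set `movedRight g`, and being increasing
it fixes every point. -/
theorem IsDyadicPL.apply_eq_of_commute {g h : I ≃ₜ I} (hg : IsDyadicPL g) (hh : IsDyadicPL h)
    (hgh : g * h = h * g) {p : I} (hp : p ∈ movedRight g) : h p = p := by
  have hc (t : I) : g (h t) = h (g t) := by
    rw [← Homeomorph.mul_apply, hgh, Homeomorph.mul_apply]
  refine eq_of_strictMono_of_mapsTo hh.strictMono hg.finite_movedRight ?_ hp
  rintro q ⟨hq, hq'⟩
  refine ⟨by rw [hc, hq], fun hev => hq' ?_⟩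
  have ht : Tendsto h (𝓝[≥] q) (𝓝[≥] (h q)) :=
    tendsto_nhdsWithin_iff.2 ⟨h.continuous.continuousAt.mono_left nhdsWithin_le_nhds, by
      filter_upwards [self_mem_nhdsWithin] with t ht
      exact hh.strictMono.monotone ht⟩
  filter_upwards [ht.eventually hev] with t ht
  rw [hc] at ht
  exact h.injective ht

theorem IsDyadicPL.movedRight_nonempty {g : I ≃ₜ I} (hg : IsDyadicPL g) (hne : g ≠ 1) :
    (movedRight g).Nonempty := by
  obtain ⟨x, hx⟩ : ∃ x, g x ≠ x := by
    by_contra! h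
    exact hne (Homeomorph.ext h)
  -- The left end of the component of the support of `g` that contains `x`.
  have hcl : IsClosed {t | g t = t ∧ t ≤ x} :=
    (isClosed_eq g.continuous continuous_id).inter isClosed_Iic
  obtain ⟨p, ⟨hp, hpx⟩, hmax⟩ := hcl.isCompact.exists_isGreatest
    ⟨0, hg.map_zero, unitInterval.nonneg'⟩
  have hlt : p < x := lt_of_le_of_ne hpx (by rintro rfl; exact hx hp)
  refine ⟨p, hp, fun hev => ?_⟩
  have := nhdsGT_neBot_of_exists_gt ⟨x, hlt⟩
  obtain ⟨t, ht, ht'⟩ := ((hev.filter_mono (nhdsWithin_mono p Set.Ioi_subset_Ici_self)).and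
    (Ioc_mem_nhdsGT hlt)).exists
  exact absurd (hmax ⟨ht, ht'.2⟩) (not_le.2 ht'.1)

/-- The elements of `F` that agree with the identity along the filter `l`. -/
def fixEventually (l : Filter I) : Subgroup thompsonF where
  carrier := {g | ∀ᶠ t in l, (g : I ≃ₜ I) t = t}
  mul_mem' := by
    intro a b ha hb
    filter_upwards [ha, hb] with t h1 h2
    rw [Subgroup.coe_mul, Homeomorph.mul_apply, h2, h1]
  one_mem' := Eventually.of_forall fun t => rfl
  inv_mem' := by
    intro a ha
    filter_upwards [ha] with t h1
    exact (Homeomorph.symm_apply_eq _).2 h1.symm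

/-- In a finitely generated abelian subgroup of `F`, the nontrivial germs occur at a fixed finite
set of common fixed points. -/
theorem exists_finite_germ_points (H : Subgroup thompsonF) (hH : ∀ a ∈ H, ∀ b ∈ H, a * b = b * a)
    (hfg : H.FG) : ∃ P : Set I, P.Finite ∧ (∀ p ∈ P, p < 1) ∧ ∀ g ∈ H, g ≠ 1 →
      ∃ p ∈ P, (∀ h ∈ H, (h : I ≃ₜ I) p = p) ∧ ¬ ∀ᶠ t in 𝓝[≥] p, (g : I ≃ₜ I) t = t := by
  obtain ⟨A, rfl⟩ := hfg
  refine ⟨⋃ a ∈ A, movedRight (a : I ≃ₜ I),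
    A.finite_toSet.biUnion fun a _ => IsDyadicPL.finite_movedRight a.2, ?_, ?_⟩
  · intro p hp
    obtain ⟨a, -, hp⟩ := Set.mem_iUnion₂.1 hp
    exact lt_one_of_mem_movedRight hp
  intro g hg hne
  obtain ⟨p, hp⟩ := IsDyadicPL.movedRight_nonempty g.2 (fun h => hne (Subtype.ext h))
  have hfix (h) (hh : h ∈ Subgroup.closure (A : Set thompsonF)) : (h : I ≃ₜ I) p = p :=
    IsDyadicPL.apply_eq_of_commute g.2 h.2 (congrArg Subtype.val (hH g hg h hh)) hp
  refine ⟨p, ?_, hfix, hp.2⟩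
  by_contra hP
  simp only [Set.mem_iUnion, not_exists] at hP
  refine hp.2 ((Subgroup.closure_le (fixEventually (𝓝[≥] p))).2 (fun a ha => ?_) hg)
  by_contra hev
  exact hP a ha ⟨hfix a (Subgroup.subset_closure ha), hev⟩

/-! ### Elements of finitely generated abelian subgroups -/

theorem length_le_numNodes {T : BinaryTree Unit} {u : List Bool} (hu : u ∈ branches T) :
    u.length ≤ T.numNodes := by
  induction T generalizing u with
  | nil => simp_all [branches]
  | node a l r hl hr =>
    simp only [branches, List.mem_append, List.mem_map] at hu
    rcases hu with ⟨u, hu, rfl⟩ | ⟨u, hu, rfl⟩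
    · have := hl hu
      simp only [List.length_cons, BinaryTree.numNodes]
      omega
    · have := hr hu
      simp only [List.length_cons, BinaryTree.numNodes]
      omega

/-- The slopes of the function of a diagram of size `n` lie between `2 ^ (-n)` and `2 ^ n`, since
they are quotients of lengths of leaf intervals. -/
theorem X.exists_slope_right (D : X) {p : I} (hp : p < 1) :
    ∃ k ∈ Set.Icc (-(D.size : ℤ)) D.size, ∀ᶠ t in 𝓝[≥] p,
      ((D.toF : I ≃ₜ I) t : ℝ) - (D.toF : I ≃ₜ I) p = (2 : ℝ) ^ k * ((t : ℝ) - p) := by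
  classical
  -- Up to the next left end of a leaf interval, `p` stays in one leaf `u` of the first tree.
  let S : Finset I := insert 1 ((branches D.1.pos).map (fun u => wordMap u 0)).toFinset
  have hne : (S.filter (p < ·)).Nonempty := ⟨1, by simp [S, hp]⟩
  have hlt := (Finset.mem_filter.1 (Finset.min'_mem _ hne)).2
  obtain ⟨u, hu, a, b, hab, ha, hb⟩ := exists_branch D.1.pos p _ hlt.le (by
    rintro u hu ⟨h1, h2⟩
    refine absurd h2 (not_lt.2 (Finset.min'_le _ _ (Finset.mem_filter.2 ⟨?_, h1⟩)))
    exact Finset.mem_insert_of_mem (by simpa using ⟨u, hu, rfl⟩))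
  set y := (S.filter (p < ·)).min' hne
  obtain ⟨i, hi⟩ := List.mem_iff_getElem?.1 hu
  obtain ⟨v, hv, huv⟩ := D.represents_toF.apply_getElem? hi
  have hul := length_le_numNodes hu
  have hvl := length_le_numNodes (List.mem_of_getElem? hv)
  rw [← D.1.carets_eq] at hvl
  refine ⟨(u.length : ℤ) - v.length, ⟨?_, ?_⟩, ?_⟩
  · simp only [X.size]
    omega
  · simp only [X.size]
    omega
  filter_upwards [Icc_mem_nhdsGE hlt] with t ht
  have hpos : (0 : ℝ) < (2 : ℝ) ^ (-(u.length : ℤ)) := by positivity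
  have ht1 : (p : ℝ) ≤ t := ht.1
  have ht2 : (t : ℝ) ≤ y := ht.2
  rw [ha, coe_wordMap] at ht1
  rw [hb, coe_wordMap] at ht2
  obtain ⟨c, rfl⟩ : ∃ c : I, t = wordMap u c := by
    refine ⟨⟨((t : ℝ) - wordMap u 0) / (2 : ℝ) ^ (-(u.length : ℤ)), ?_, ?_⟩, ?_⟩
    · refine div_nonneg ?_ hpos.le
      nlinarith [a.2.1]
    · rw [div_le_one hpos]
      nlinarith [b.2.2]
    · apply Subtype.ext
      rw [coe_wordMap]
      field_simp
      ring
  rw [ha, huv, huv, coe_wordMap v c, coe_wordMap v a, coe_wordMap u c, coe_wordMap u a,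
    sub_eq_add_neg (u.length : ℤ), zpow_add₀ two_ne_zero, zpow_natCast,
    zpow_neg _ (u.length : ℤ), zpow_natCast]
  field_simp
  ring

/-- A finitely generated abelian subgroup has polynomial growth with respect to the size of
reduced diagrams. -/
theorem exists_ncard_le_pow (H : Subgroup thompsonF) (hH : ∀ a ∈ H, ∀ b ∈ H, a * b = b * a)
    (hfg : H.FG) : ∃ m : ℕ, ∀ n : ℕ,
      {D : X | D.toF ∈ H ∧ D.size ≤ n}.ncard ≤ (2 * n + 1) ^ m := by
  obtain ⟨P, hPfin, hP1, hP⟩ := exists_finite_germ_points H hH hfg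
  have := hPfin.fintype
  refine ⟨Fintype.card P, fun n => ?_⟩
  -- `κ D p` is the binary logarithm of the slope to the right of `p`.
  choose κ hκ hκ' using fun (D : X) (p : P) => D.exists_slope_right (hP1 p p.2)
  have hcard : (2 * n + 1) ^ Fintype.card P =
      (Fintype.piFinset fun _ : P => Finset.Icc (-(n : ℤ)) n).card := by
    rw [Fintype.card_piFinset, Finset.prod_const, Finset.card_univ, Int.card_Icc]
    congr 1
    omega
  rw [hcard, ← Set.ncard_coe_finset]
  refine Set.ncard_le_ncard_of_injOn κ ?_ ?_ (Finset.finite_toSet _)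
  · rintro D ⟨-, hD⟩
    simp only [Finset.mem_coe, Fintype.mem_piFinset, Finset.mem_Icc]
    intro p
    have h1 := hκ D p
    rw [Set.mem_Icc] at h1
    omega
  · rintro D ⟨hD, -⟩ D' ⟨hD', -⟩ h
    apply X.toF_injective
    by_contra hne
    obtain ⟨p, hp, hfix, hev⟩ := hP (D'.toF⁻¹ * D.toF) (H.mul_mem (H.inv_mem hD') hD)
      (fun h => hne (inv_mul_eq_one.1 h).symm)
    refine hev ?_
    filter_upwards [hκ' D ⟨p, hp⟩, hκ' D' ⟨p, hp⟩] with t h1 h2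
    rw [hfix _ hD] at h1
    rw [hfix _ hD', ← h, ← h1] at h2
    rw [Subgroup.coe_mul, Homeomorph.mul_apply]
    exact (Homeomorph.symm_apply_eq _).2 (Subtype.ext (by linarith))

/-! ### Spheres in the set of tuples -/

theorem card_sym_le_pow (α : Type*) [Finite α] (k : ℕ) : Nat.card (Sym α k) ≤ Nat.card α ^ k := by
  have := Fintype.ofFinite α
  calc Nat.card (Sym α k) ≤ Nat.card (List.Vector α k) :=
        Nat.card_le_card_of_surjective Sym.ofVector (by
          rintro ⟨s, hs⟩
          induction s using Quotient.inductionOn with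
          | h l => exact ⟨⟨l, hs⟩, rfl⟩)
    _ = Nat.card α ^ k := by simp [card_vector]

theorem ncard_sym_le_pow {α : Type*} {s : Set α} (hs : s.Finite) (k : ℕ) :
    {t : Sym α k | ∀ a ∈ t, a ∈ s}.ncard ≤ s.ncard ^ k := by
  have := hs.to_subtype
  have hsub : {t : Sym α k | ∀ a ∈ t, a ∈ s} ⊆
      (fun t : Sym s k => t.map Subtype.val) '' Set.univ := by
    intro t ht
    refine ⟨t.attach.map (fun a => ⟨a.1, ht a.1 a.2⟩), trivial, ?_⟩
    simp only [Sym.map_map, Function.comp_def]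
    exact Sym.attach_map_coe t
  calc _ ≤ _ := Set.ncard_le_ncard hsub (Set.finite_univ.image _)
    _ ≤ (Set.univ : Set (Sym s k)).ncard := Set.ncard_image_le Set.finite_univ
    _ ≤ s.ncard ^ k := by
      rw [Set.ncard_univ]
      exact card_sym_le_pow s k

/-- The tree-diagram of size zero, which represents the identity. -/
def trivialDiagram : X :=
  ⟨⟨.nil, .nil, rfl⟩, by rintro ⟨i, u, v, -, h, -⟩; simp [branches] at h⟩

/-- A polynomial bound on the numerators suffices for density zero, because the spheres grow
exponentially: for a notion of size that is at least the size of each component, and for which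
padding by trivial diagrams does not change the size of a single diagram. -/
theorem hasAsymptoticDensity_zero {k : ℕ} {size : Sym X (k + 1) → ℕ}
    (hfin : ∀ n, (Sph size n).Finite) (hle : ∀ s, ∀ D ∈ s, D.size ≤ size s)
    (hpad : ∀ D : X, size (D ::ₛ Sym.replicate k trivialDiagram) = D.size)
    {H : Subgroup thompsonF} {m : ℕ}
    (hm : ∀ n : ℕ, {D : X | D.toF ∈ H ∧ D.size ≤ n}.ncard ≤ (2 * n + 1) ^ m) :
    HasAsymptoticDensity size (tuplesIn (k + 1) H) 0 := by
  have hupper (n : ℕ) :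
      (tuplesIn (k + 1) H ∩ Sph size n).ncard ≤ (2 * n + 1) ^ (m * (k + 1)) := by
    have hE : {D : X | D.toF ∈ H ∧ D.size ≤ n}.Finite :=
      (finite_size_le n).subset fun D hD => hD.2
    rw [pow_mul]
    refine le_trans (Set.ncard_le_ncard (t := {s | ∀ D ∈ s, D ∈ {D : X | D.toF ∈ H ∧ D.size ≤ n}})
      ?_ ?_) ((ncard_sym_le_pow hE _).trans (Nat.pow_le_pow_left (hm n) _))
    · rintro s ⟨h1, h2⟩ D hD
      exact ⟨h1 D hD, (hle s D hD).trans (le_of_eq h2)⟩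
    · refine (finite_maxSize_le (k + 1) n).subset fun s hs =>
        Multiset.sup_le (a := n).2 fun b hb => ?_
      obtain ⟨D, hD, rfl⟩ := Multiset.mem_map.1 hb
      exact (hs D hD).2
  have hlower (n : ℕ) (hn : n ≠ 0) : 4 ^ n ≤ 2 * (n + 1) ^ 2 * (Sph size (n + 1)).ncard := by
    refine (four_pow_le_catalan n hn).trans (Nat.mul_le_mul_left _ ?_)
    refine (catalan_le_ncard n hn).trans (Set.ncard_le_ncard_of_injOn
      (fun D => D ::ₛ Sym.replicate k trivialDiagram) ?_ ?_ (hfin _))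
    · intro D hD
      exact (hpad D).trans hD
    · intro D _ D' _ h
      exact (Sym.cons_inj_left _ _ _).1 h
  set M := m * (k + 1)
  -- With `c = n + 1`, the numerator is at most `(3 * c) ^ M`, and the reciprocal of the denominator
  -- at most `2 * c ^ 2 / 4 ^ n = 8 * c ^ 2 / 4 ^ c`.
  have hlim : Tendsto (fun n : ℕ => (8 * 3 ^ M : ℝ) * ((n : ℝ) ^ (M + 2) / 4 ^ n)) atTop (𝓝 0) := by
    simpa using (tendsto_pow_const_div_const_pow_of_one_lt (M + 2)
      (by norm_num : (1 : ℝ) < 4)).const_mul (8 * 3 ^ M : ℝ)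
  refine squeeze_zero' (Eventually.of_forall fun n => by unfold proportion; positivity) ?_ hlim
  filter_upwards [eventually_ge_atTop 2] with n hn
  obtain ⟨n, rfl⟩ : ∃ j, n = j + 1 := ⟨n - 1, by omega⟩
  have h1 : ((tuplesIn (k + 1) H ∩ Sph size (n + 1)).ncard : ℝ) ≤ 3 ^ M * ((n + 1 : ℕ) : ℝ) ^ M := by
    rw [← mul_pow]
    exact_mod_cast (hupper (n + 1)).trans (Nat.pow_le_pow_left (by omega) _)
  have h2 : (4 : ℝ) ^ n ≤ 2 * ((n + 1 : ℕ) : ℝ) ^ 2 * (Sph size (n + 1)).ncard := by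
    exact_mod_cast hlower n (by omega)
  have h3 : (0 : ℝ) < (Sph size (n + 1)).ncard := by
    by_contra! h
    have : (0 : ℝ) < 4 ^ n := by positivity
    have : 2 * ((n + 1 : ℕ) : ℝ) ^ 2 * (Sph size (n + 1)).ncard ≤ 0 :=
      mul_nonpos_of_nonneg_of_nonpos (by positivity) h
    linarith
  rw [proportion, ← mul_div_assoc, div_le_div_iff₀ h3 (by positivity)]
  set c := ((n + 1 : ℕ) : ℝ)
  set N := ((Sph size (n + 1)).ncard : ℝ)
  calc _ ≤ (3 ^ M * c ^ M) * (4 * (2 * c ^ 2 * N)) := by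
        rw [pow_succ, mul_comm _ (4 : ℝ)]
        gcongr
    _ = _ := by ring

end ThompsonF

/-! ### Density of tuples in abelian subgroups -/

open ThompsonF in
theorem mainTheorem3 (H : Subgroup thompsonF) (hH : ∀ a ∈ H, ∀ b ∈ H, a * b = b * a) :
    (¬ IsPerpetual (fun _ => sumSize) H ∧ ¬ IsPerpetual (fun _ => maxSize) H) ∧
    (H.FG → ∀ k : ℕ, 1 ≤ k →
      HasAsymptoticDensity sumSize (tuplesIn k H) 0 ∧
      HasAsymptoticDensity maxSize (tuplesIn k H) 0) := by
  have hdens : H.FG → ∀ k : ℕ, 1 ≤ k →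
      HasAsymptoticDensity sumSize (tuplesIn k H) 0 ∧
      HasAsymptoticDensity maxSize (tuplesIn k H) 0 := by
    intro hfg k hk
    obtain ⟨m, hm⟩ := exists_ncard_le_pow H hH hfg
    obtain ⟨k, rfl⟩ : ∃ j, k = j + 1 := ⟨k - 1, by omega⟩
    have hzero : trivialDiagram.size = 0 := rfl
    constructor
    · refine hasAsymptoticDensity_zero (finite_Sph_sumSize _) (fun s D hD => ?_) (fun D => ?_) hm
      · exact Multiset.single_le_sum (fun _ _ => Nat.zero_le _) _ (Multiset.mem_map_of_mem _ hD)
      · simp only [sumSize, Sym.coe_cons, Sym.coe_replicate, Multiset.map_cons,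
          Multiset.map_replicate, hzero, Multiset.sum_cons]
        simp
    · refine hasAsymptoticDensity_zero (finite_Sph_maxSize _) (fun s D hD => ?_) (fun D => ?_) hm
      · exact Multiset.le_sup (Multiset.mem_map_of_mem _ hD)
      · have h0 : (Multiset.replicate k 0).sup = 0 :=
          Nat.le_zero.1 (Multiset.sup_le.2 fun b hb => (Multiset.eq_of_mem_replicate hb).le)
        simp only [maxSize, Sym.coe_cons, Sym.coe_replicate, Multiset.map_cons,
          Multiset.map_replicate, hzero, Multiset.sup_cons, h0]
        simp
  have hgen (size : (k : ℕ) → Sym X k → ℕ)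
      (hsize : H.FG → ∀ k : ℕ, 1 ≤ k → HasAsymptoticDensity (size k) (tuplesIn k H) 0)
      (hfin : ∀ k n, (Sph (size k) n).Finite) : ¬ IsPerpetual size H := by
    rintro ⟨K, hK⟩
    have hpos := hK (max K 1) (le_max_left _ _)
    suffices h : Tendsto (proportion (size _) (tuplesGenerating (max K 1) H)) atTop (𝓝 0) by
      rw [HasPositiveDensity, h.liminf_eq] at hpos
      exact lt_irrefl _ hpos
    by_cases hfg : H.FG
    · refine squeeze_zero (fun n => by unfold proportion; positivity) (fun n => ?_)
        (hsize hfg (max K 1) (le_max_right _ _))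
      refine div_le_div_of_nonneg_right (Nat.cast_le.2 (Set.ncard_le_ncard ?_
        ((hfin _ n).inter_of_right _))) (Nat.cast_nonneg _)
      rintro s ⟨hs, hs'⟩
      refine ⟨fun D hD => ?_, hs'⟩
      have hs : Subgroup.closure {g | ∃ D ∈ s, D.toF = g} = H := hs
      rw [← hs]
      exact Subgroup.subset_closure ⟨D, hD, rfl⟩
    · -- A tuple generates a finitely generated subgroup, which is not `H`.
      have hempty : tuplesGenerating (max K 1) H = ∅ := by
        refine Set.eq_empty_of_forall_notMem fun s hs => hfg ?_
        refine (Subgroup.fg_iff H).2 ⟨_, hs, ?_⟩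
        classical
        exact (((s : Multiset X).toFinset.finite_toSet).image X.toF).subset (by
          rintro _ ⟨D, hD, rfl⟩
          exact ⟨D, by simpa using hD, rfl⟩)
      have hzero : proportion (size _) (tuplesGenerating (max K 1) H) = fun _ => 0 := by
        ext n
        simp [proportion, hempty]
      rw [hzero]
      exact tendsto_const_nhds
  exact ⟨⟨hgen _ (fun hfg k hk => (hdens hfg k hk).1) finite_Sph_sumSize,
    hgen _ (fun hfg k hk => (hdens hfg k hk).2) finite_Sph_maxSize⟩, hdens⟩
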